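/- Conventions. Write $\Pi_n^N$ for the real polynomials in $N$ variables of total degree at most $n$, $\|g\|_{C(\Omega)}=\sup_{x\in\Omega}|g(x)|$, and $$E_n(f;\Omega)=\inf_{p\in\Pi_n^N}\|f-p\|_{C(\Omega)}$$ for a compact set $\Omega\subset\mathbb R^N$. A function $g=f-p$ with $p\in\Pi_n^N$ and $\|g\|_{C(\Omega)}=E_n(f;\Omega)$ is called a polynomial of least deviation from zero for $E_n(f;\Omega)$. Let $T^N=\{x\in\mathbb R^N: x_i\ge 0,\ x_1+\cdots+x_N\le 1\}$, and let $B^d$ and $S^{d-1}$ be the closed Euclidean unit ball and the unit sphere of $\mathbb R^d$. With $e_k$ the elementary symmetric polynomial of degree $k$ (in any number of variables), put $r_3=72$, $$T_3=72e_3-4e_1+4e_1^2-8e_2+1,$$ and, for $k>3$, $$r_k=k^k\Big(T_{k-1}\big(\underbrace{\tfrac1k,\ldots,\tfrac1k}_{k}\big)+1\Big),\qquad T_k=r_ke_k-T_{k-1}.$$ Theorem. Let $d\ge 3$. Then $r_d>0$, $$E_{d-1}(x_1\cdots x_d;T^d)=E_{d-1}\big(x_1\cdots x_{d-1}(1-x_1-\cdots-x_{d-1});T^{d-1}\big)\ge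 r_d^{-1},$$ and $$E_{2d-1}(x_1^2\cdots x_d^2;B^d)=E_{2d-1}(x_1^2\cdots x_d^2;S^{d-1})\ge r_d^{-1}.$$ For $d=3,4,5$ all four quantities are equal to $r_d^{-1}$, and the following are polynomials of least deviation from zero: $r_d^{-1}T_d(x_1,\ldots,x_d)$ for the first, $r_d^{-1}T_d(x_1,\ldots,x_{d-1},1-x_1-\cdots-x_{d-1})$ for the second, and $r_d^{-1}T_d(x_1^2,\ldots,x_d^2)$ for the third and the fourth. -/

import Mathlib

namespace LeastDeviation

open MvPolynomial

/-- The uniform norm on `Ω` of a real function on `ℝ^N`. It is only applied to polynomial functions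
and compact nonempty `Ω`, where the supremum is that of a bounded nonempty set. -/
noncomputable def supNorm {N : ℕ} (Ω : Set (Fin N → ℝ)) (g : (Fin N → ℝ) → ℝ) : ℝ :=
  sSup ((fun x => |g x|) '' Ω)

/-- `bestApprox n f Ω` is the error `E_n(f; Ω)` of best uniform approximation of `f` on `Ω` by
polynomials in `N` variables of total degree at most `n`. -/
noncomputable def bestApprox {N : ℕ} (n : ℕ) (f : (Fin N → ℝ) → ℝ) (Ω : Set (Fin N → ℝ)) : ℝ :=
  sInf {s : ℝ | ∃ p : MvPolynomial (Fin N) ℝ,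
    p.totalDegree ≤ n ∧ s = supNorm Ω (fun x => f x - eval x p)}

/-- `g` is a polynomial of least deviation from zero for `f` and degree `n` on `Ω`: it has the form
`g = f - p` where `p`, of total degree at most `n`, is a best approximation of `f` on `Ω`. -/
def IsLeastDeviation {N : ℕ} (n : ℕ) (f : (Fin N → ℝ) → ℝ) (Ω : Set (Fin N → ℝ))
    (g : (Fin N → ℝ) → ℝ) : Prop :=
  ∃ p : MvPolynomial (Fin N) ℝ, p.totalDegree ≤ n ∧ (∀ x, g x = f x - eval x p) ∧
    supNorm Ω g = bestApprox n f Ω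

/-- The simplex `T^N` of points with nonnegative coordinates of sum at most one. -/
def simplex (N : ℕ) : Set (Fin N → ℝ) := {x | (∀ i, 0 ≤ x i) ∧ ∑ i, x i ≤ 1}

/-- The closed unit ball `B^N` of the Euclidean norm. -/
def ball (N : ℕ) : Set (Fin N → ℝ) := {x | ‖(WithLp.toLp 2 x : EuclideanSpace ℝ (Fin N))‖ ≤ 1}

/-- The unit sphere `S^(N-1)` of the Euclidean norm of `ℝ^N`. -/
def sphere (N : ℕ) : Set (Fin N → ℝ) := {x | ‖(WithLp.toLp 2 x : EuclideanSpace ℝ (Fin N))‖ = 1}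

/-- The number `k^k (P(1/k, …, 1/k) + 1)` for a polynomial `P` in `k` variables. -/
noncomputable def nextR (k : ℕ) (P : MvPolynomial (Fin k) ℝ) : ℝ :=
  (k : ℝ) ^ k * (eval (fun _ => 1 / (k : ℝ)) P + 1)

/-- The symmetric polynomial `T_k` in `N` variables, for `k ≥ 3` (the values at `k < 3` are not
used): `T_3 = 72 e_3 - 4 e_1 + 4 e_1^2 - 8 e_2 + 1` and `T_k = r_k e_k - T_(k-1)` for `k > 3`. -/
noncomputable def T : ℕ → (N : ℕ) → MvPolynomial (Fin N) ℝ
  | 0, _ => 0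
  | 1, _ => 0
  | 2, _ => 0
  | 3, N => 72 * esymm (Fin N) ℝ 3 - 4 * esymm (Fin N) ℝ 1 + 4 * esymm (Fin N) ℝ 1 ^ 2
      - 8 * esymm (Fin N) ℝ 2 + 1
  | k + 4, N => C (nextR (k + 4) (T (k + 3) (k + 4))) * esymm (Fin N) ℝ (k + 4) - T (k + 3) N

/-- The constants `r_3 = 72` and `r_k = k^k (T_(k-1)(1/k, …, 1/k) + 1)` for `k > 3`, where `T_(k-1)`
is taken in `k` variables (the values at `k < 3` are not used). -/
noncomputable def r : ℕ → ℝ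
  | 0 => 0
  | 1 => 0
  | 2 => 0
  | 3 => 72
  | k + 4 => nextR (k + 4) (T (k + 3) (k + 4))

/-- The recursion `T_k = r_k e_k - T_(k-1)` for `k > 3`. -/
theorem T_succ (k N : ℕ) : T (k + 4) N = C (r (k + 4)) * esymm (Fin N) ℝ (k + 4) - T (k + 3) N := by
  simp only [T, r]

/-- The point `(x_1, …, x_(d-1), 1 - x_1 - ⋯ - x_(d-1))` of `ℝ^d`. -/
noncomputable def faceLift (d : ℕ) (x : Fin (d - 1) → ℝ) : Fin d → ℝ :=
  fun i => if h : (i : ℕ) < d - 1 then x ⟨i, h⟩ else 1 - ∑ j, x j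

end LeastDeviation

/-!
All four errors equal `r_d⁻¹`, for every `d ≥ 3`.

Lower bound. The functional `L(g) = ∑_S (-1)^|S| |S|^(d-1) g(1_S / |S|)` on the barycenters of the
faces of the simplex `x_1 + ⋯ + x_d = 1` vanishes on polynomials of degree less than `d`
(`sum_alternating_eval_eq_zero`): for a monomial it is a finite difference of too high an order.
Its value at `x_1 ⋯ x_d` is `±1/d`, and `T_d` takes the values `±1` at the barycenters with the signs
of `L`, up to a common factor (`flatT_inv`). Comparing `L(T_d)` with `r_d L(x_1 ⋯ x_d)` yields the closed form
`r_d = d ∑_j (d choose j) j^(d-1)` (`r_eq_rSum`), so `r_d > 0`, and the total mass of `L` shows that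
no polynomial of degree less than `d` is closer than `r_d⁻¹` to `x_1 ⋯ x_d` on that face
(`exists_inv_r_le`). On the sphere, averaging over sign changes reduces a polynomial of degree at
most `2d - 1` to a polynomial of degree at most `d - 1` in the squares of the coordinates
(`exists_inv_r_le_sphere`).

Upper bound. It suffices to find `G = r_d e_d + (lower degree)` with `|G| ≤ 1` on the whole simplex;
restriction to the face and the substitution `x_i ↦ x_i ^ 2` then settle all four sets
(`isLeastDeviation_of_abs_le_one`). If `G` is a linear combination of elementary symmetric
polynomials plus a function of `x_1 + ⋯ + x_d`, then on each slice `x_1 + ⋯ + x_d = t` its extrema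
are attained at points whose nonzero coordinates are all equal (`IsPairAffine.exists_flat_le`),
which leaves inequalities in one variable. For `d = 3, 4, 5` these are checked directly for
`G = T_d`. For general `d` the polynomial `extremal d` is used, which agrees with `T_d` on the face
`x_1 + ⋯ + x_d = 1`: its value at a point with `j` coordinates equal to `s` is, up to sign, an
alternating sum of the probabilities `(j choose i) (is)^i (1 - is)^(j-i-1) (1 - js)`, which add up
to one by Abel's identity (`sum_choose_mul_abelWeight`).
-/

namespace LeastDeviation

open Finset MvPolynomial

/-! ### Extrema of symmetric multi-affine functions on slices of the orthant -/

/-- The point with coordinates `a` on `S` and `0` elsewhere. -/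
def flat {ι : Type*} [DecidableEq ι] (S : Finset ι) (a : ℝ) : ι → ℝ :=
  fun i => if i ∈ S then a else 0

/-- When two coordinates of the argument vary with constant sum, `F` is an affine function of their
product. This holds for elementary symmetric polynomials and for functions of the sum of the
coordinates. -/
def IsPairAffine {ι : Type*} [DecidableEq ι] (F : (ι → ℝ) → ℝ) : Prop :=
  ∀ (x : ι → ℝ) (i j : ι), i ≠ j → ∃ c : ℝ, ∀ u v : ℝ, u + v = x i + x j →
    F (Function.update (Function.update x i u) j v) = F x + c * (u * v - x i * x j)

section Slices

variable {ι : Type*} [DecidableEq ι]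

theorem IsPairAffine.add {F G : (ι → ℝ) → ℝ} (hF : IsPairAffine F) (hG : IsPairAffine G) :
    IsPairAffine fun x => F x + G x := by
  intro x i j hij
  obtain ⟨c, hc⟩ := hF x i j hij
  obtain ⟨e, he⟩ := hG x i j hij
  refine ⟨c + e, fun u v huv => ?_⟩
  simp only [hc u v huv, he u v huv]
  ring

theorem IsPairAffine.const_mul {F : (ι → ℝ) → ℝ} (hF : IsPairAffine F) (b : ℝ) :
    IsPairAffine fun x => b * F x := by
  intro x i j hij
  obtain ⟨c, hc⟩ := hF x i j hij
  refine ⟨b * c, fun u v huv => ?_⟩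
  simp only [hc u v huv]
  ring

theorem IsPairAffine.neg {F : (ι → ℝ) → ℝ} (hF : IsPairAffine F) :
    IsPairAffine fun x => -F x := by
  simpa using hF.const_mul (-1)

variable [Fintype ι]

theorem sum_update_update (x : ι → ℝ) {i j : ι} (hij : i ≠ j) {u v : ℝ} (huv : u + v = x i + x j) :
    ∑ k, Function.update (Function.update x i u) j v k = ∑ k, x k := by
  rw [Finset.sum_update_of_mem (mem_univ j), ← Finset.add_sum_erase univ x (mem_univ j),
    ← Finset.erase_eq, Finset.sum_update_of_mem (by simpa using hij),
    ← Finset.add_sum_erase (univ.erase j) x (a := i) (by simpa using hij), ← Finset.erase_eq]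
  linarith

theorem isPairAffine_comp_sum (h : ℝ → ℝ) : IsPairAffine fun x : ι → ℝ => h (∑ i, x i) := by
  intro x i j hij
  refine ⟨0, fun u v huv => ?_⟩
  simp only [sum_update_update x hij huv]
  ring

theorem sum_flat (S : Finset ι) (a : ℝ) : ∑ i, flat S a i = #S * a := by
  simp [flat]

/-- On the slice of the nonnegative orthant where the sum of the coordinates is fixed, a continuous
pair-affine function attains its maximum at a point whose nonzero coordinates are equal: at a
maximizer with smallest support, two different nonzero coordinates could be either equalized or
merged. -/
theorem IsPairAffine.exists_flat_le {F : (ι → ℝ) → ℝ} (hF : IsPairAffine F) (hc : Continuous F)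
    (x : ι → ℝ) (hx : ∀ i, 0 ≤ x i) :
    ∃ (S : Finset ι) (a : ℝ), 0 ≤ a ∧ #S * a = ∑ i, x i ∧ F x ≤ F (flat S a) := by
  set K : Set (ι → ℝ) := {y | (∀ i, 0 ≤ y i) ∧ ∑ i, y i = ∑ i, x i} with hK
  have hcl : IsClosed K := by
    have h1 : IsClosed {y : ι → ℝ | ∀ i, 0 ≤ y i} := by
      simp only [Set.ofPred_forall]
      exact isClosed_iInter fun i => isClosed_le continuous_const (continuous_apply i)
    exact h1.inter (isClosed_eq (by fun_prop) continuous_const)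
  have hcomp : IsCompact K := by
    refine (isCompact_Icc (a := (0 : ι → ℝ)) (b := fun _ => ∑ i, x i)).of_isClosed_subset hcl ?_
    intro y hy
    refine ⟨fun i => hy.1 i, fun i => ?_⟩
    rw [← hy.2]
    exact Finset.single_le_sum (fun k _ => hy.1 k) (mem_univ i)
  obtain ⟨m, hmK, hm⟩ := hcomp.exists_isMaxOn ⟨x, hx, rfl⟩ hc.continuousOn
  obtain ⟨z, ⟨hzK, hzm⟩, hzmin⟩ := (measure fun y : ι → ℝ => #{i | y i ≠ 0}).wf.has_min
    {y | y ∈ K ∧ F m ≤ F y} ⟨m, hmK, le_rfl⟩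
  have hzmax : ∀ y ∈ K, F y ≤ F z := fun y hy => (hm hy).trans hzm
  have heq : ∀ i j, z i ≠ 0 → z j ≠ 0 → z i = z j := by
    intro i j hi hj
    by_contra hne
    have hij : i ≠ j := fun h => hne (by rw [h])
    have hi0 := lt_of_le_of_ne (hzK.1 i) hi.symm
    have hj0 := lt_of_le_of_ne (hzK.1 j) hj.symm
    obtain ⟨c, hcF⟩ := hF z i j hij
    have hmem : ∀ u v, 0 ≤ u → 0 ≤ v → u + v = z i + z j →
        Function.update (Function.update z i u) j v ∈ K := by
      intro u v hu hv huv
      refine ⟨fun k => ?_, (sum_update_update z hij huv).trans hzK.2⟩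
      simp only [Function.update_apply]
      split_ifs
      exacts [hv, hu, hzK.1 k]
    rcases lt_or_ge 0 c with hpos | hnonpos
    · have h1 := hzmax _ (hmem ((z i + z j) / 2) ((z i + z j) / 2) (by positivity) (by positivity)
        (by ring))
      rw [hcF _ _ (by ring)] at h1
      have h2 : 0 < (z i - z j) ^ 2 := by
        have := sub_ne_zero.2 hne
        positivity
      nlinarith [mul_pos hpos h2]
    · refine hzmin (Function.update (Function.update z i (z i + z j)) j 0)
        ⟨hmem _ _ (by positivity) le_rfl (by ring), ?_⟩ ?_
      · rw [hcF _ _ (by ring)]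
        nlinarith [mul_pos hi0 hj0]
      · refine Finset.card_lt_card (Finset.ssubset_iff_of_subset ?_ |>.2 ⟨j, ?_, ?_⟩)
        · intro k
          simp only [Function.update_apply, mem_filter, mem_univ, true_and]
          split_ifs with h1 h2
          · simp
          · intro _
            rw [h2]
            exact hi
          · exact id
        · simpa using hj
        · simp
  have hflat : ∃ a, 0 ≤ a ∧ z = flat {i | z i ≠ 0} a := by
    by_cases h : ∃ i, z i ≠ 0
    · obtain ⟨i, hi⟩ := h
      refine ⟨z i, hzK.1 i, funext fun k => ?_⟩
      by_cases hk : z k = 0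
      · simp [flat, hk]
      · simp [flat, heq k i hk hi]
    · push Not at h
      exact ⟨0, le_rfl, funext fun k => by simp [flat, h]⟩
  obtain ⟨a, ha, hza⟩ := hflat
  refine ⟨_, a, ha, ?_, hza ▸ hzmax x ⟨hx, rfl⟩⟩
  rw [← sum_flat, ← hza, hzK.2]

end Slices

/-! ### Elementary symmetric polynomials -/

theorem eval_esymm {N : ℕ} (x : Fin N → ℝ) (k : ℕ) :
    eval x (esymm (Fin N) ℝ k) = ∑ t ∈ powersetCard k univ, ∏ i ∈ t, x i := by
  simp [esymm]

theorem eval_esymm_one {N : ℕ} (x : Fin N → ℝ) : eval x (esymm (Fin N) ℝ 1) = ∑ i, x i := by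
  simp [esymm_one]

theorem eval_esymm_card {N : ℕ} (x : Fin N → ℝ) : eval x (esymm (Fin N) ℝ N) = ∏ i, x i := by
  have h : powersetCard N (univ : Finset (Fin N)) = {univ} := by
    simpa using powersetCard_self (univ : Finset (Fin N))
  rw [eval_esymm, h, sum_singleton]

theorem eval_esymm_eq_coeff {N : ℕ} (x : Fin N → ℝ) (k : ℕ) :
    eval x (esymm (Fin N) ℝ k) = (∏ i, (1 + Polynomial.C (x i) * Polynomial.X)).coeff k := by
  rw [eval_esymm, prod_one_add, Polynomial.finsetSum_coeff, powersetCard_eq_filter, sum_filter]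
  refine sum_congr rfl fun t _ => ?_
  rw [prod_mul_distrib, prod_const, ← map_prod, Polynomial.coeff_C_mul, Polynomial.coeff_X_pow]
  simp [eq_comm]

theorem isPairAffine_esymm (N k : ℕ) : IsPairAffine fun x => eval x (esymm (Fin N) ℝ k) := by
  intro x i j hij
  simp only [eval_esymm_eq_coeff]
  set R : Polynomial ℝ :=
    ∏ l ∈ (univ.erase i).erase j, (1 + Polynomial.C (x l) * Polynomial.X) with hR
  have key : ∀ y : Fin N → ℝ, (∀ l, l ≠ i → l ≠ j → y l = x l) →
      (∏ l, (1 + Polynomial.C (y l) * Polynomial.X)).coeff k =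
        R.coeff k + (y i + y j) * (Polynomial.X * R).coeff k
          + y i * y j * (Polynomial.X ^ 2 * R).coeff k := by
    intro y hy
    have h1 : (∏ l, (1 + Polynomial.C (y l) * Polynomial.X)) =
        R + Polynomial.C (y i + y j) * (Polynomial.X * R)
          + Polynomial.C (y i * y j) * (Polynomial.X ^ 2 * R) := by
      rw [← mul_prod_erase univ _ (mem_univ i),
        ← mul_prod_erase (univ.erase i) _ (mem_erase.2 ⟨hij.symm, mem_univ j⟩), hR,
        prod_congr rfl fun l hl => ?_, map_add, map_mul]
      · ring
      · simp only [mem_erase, mem_univ, and_true] at hl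
        rw [hy l hl.2 hl.1]
    rw [h1]
    simp only [Polynomial.coeff_add, Polynomial.coeff_C_mul]
  refine ⟨(Polynomial.X ^ 2 * R).coeff k, fun u v huv => ?_⟩
  rw [key x fun _ _ _ => rfl, key]
  · simp only [Function.update_self, Function.update_of_ne hij]
    rw [huv]
    ring
  · intro l hli hlj
    rw [Function.update_of_ne hlj, Function.update_of_ne hli]

theorem eval_flat_esymm {N : ℕ} (S : Finset (Fin N)) (a : ℝ) (k : ℕ) :
    eval (flat S a) (esymm (Fin N) ℝ k) = (#S).choose k * a ^ k := by
  have hsub : powersetCard k S ⊆ powersetCard k univ := powersetCard_mono (subset_univ S)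
  rw [eval_esymm, ← sum_subset hsub]
  · rw [sum_congr rfl (g := fun _ => a ^ k), sum_const, card_powersetCard, nsmul_eq_mul]
    intro t ht
    rw [mem_powersetCard] at ht
    rw [prod_congr rfl (g := fun _ => a), prod_const, ht.2]
    intro i hi
    simp [flat, ht.1 hi]
  · intro t ht hts
    simp only [mem_powersetCard, subset_univ, true_and] at ht hts
    obtain ⟨i, hi, hiS⟩ := not_subset.1 fun h => hts ⟨h, ht⟩
    exact prod_eq_zero hi (by simp [flat, hiS])

theorem totalDegree_esymm_le (N k : ℕ) : (esymm (Fin N) ℝ k).totalDegree ≤ k := by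
  refine totalDegree_finsetSum_le fun t ht => ?_
  rw [mem_powersetCard] at ht
  refine (totalDegree_finsetProd _ _).trans ?_
  simp [ht.2]

/-! ### The polynomials `T_k` at flat points -/

theorem T_three (N : ℕ) : T 3 N = 72 * esymm (Fin N) ℝ 3 - 4 * esymm (Fin N) ℝ 1
    + 4 * esymm (Fin N) ℝ 1 ^ 2 - 8 * esymm (Fin N) ℝ 2 + 1 := by
  simp only [T]

theorem totalDegree_C_mul_le {N : ℕ} (c : ℝ) (p : MvPolynomial (Fin N) ℝ) :
    (C c * p).totalDegree ≤ p.totalDegree := by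
  rw [← smul_eq_C_mul]
  exact totalDegree_smul_le _ _

theorem exists_T_eq (k N : ℕ) : ∃ p : MvPolynomial (Fin N) ℝ, p.totalDegree ≤ k + 2 ∧
    T (k + 3) N = C (r (k + 3)) * esymm (Fin N) ℝ (k + 3) + p := by
  induction k with
  | zero =>
    have h1 := totalDegree_esymm_le N 1
    have h2 := totalDegree_esymm_le N 2
    refine ⟨C (-4) * esymm (Fin N) ℝ 1 + C 4 * esymm (Fin N) ℝ 1 ^ 2
      + C (-8) * esymm (Fin N) ℝ 2 + C 1, ?_, ?_⟩
    · refine (totalDegree_add _ _).trans (max_le ((totalDegree_add _ _).trans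
        (max_le ((totalDegree_add _ _).trans (max_le ?_ ?_)) ?_)) (by simp))
      · exact (totalDegree_C_mul_le _ _).trans (by omega)
      · exact (totalDegree_C_mul_le _ _).trans ((totalDegree_pow _ _).trans (by omega))
      · exact (totalDegree_C_mul_le _ _).trans (by omega)
    · have e : ((C 72 : MvPolynomial (Fin N) ℝ) = 72) ∧ (C (-4) : MvPolynomial (Fin N) ℝ) = -4
        ∧ (C 4 : MvPolynomial (Fin N) ℝ) = 4 ∧ (C (-8) : MvPolynomial (Fin N) ℝ) = -8 := by
        refine ⟨?_, ?_, ?_, ?_⟩ <;> simp [← map_ofNat C]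
      rw [zero_add, T_three, r, e.1, e.2.1, e.2.2.1, e.2.2.2, map_one]
      ring
  | succ k ih =>
    obtain ⟨p, hp, hTp⟩ := ih
    refine ⟨-T (k + 3) N, ?_, by rw [T_succ, sub_eq_add_neg]⟩
    rw [totalDegree_neg, hTp]
    exact (totalDegree_add _ _).trans (max_le ((totalDegree_C_mul_le _ _).trans
      (totalDegree_esymm_le _ _)) (by omega))

/-- The value of `T_(k+3)` at a point with `j` coordinates equal to `a` and the others zero. -/
noncomputable def flatT : ℕ → ℕ → ℝ → ℝ
  | 0, j, a => 72 * (j.choose 3 * a ^ 3) - 4 * (j * a) + 4 * (j * a) ^ 2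
      - 8 * (j.choose 2 * a ^ 2) + 1
  | k + 1, j, a => r (k + 4) * (j.choose (k + 4) * a ^ (k + 4)) - flatT k j a

theorem eval_flat_T {N : ℕ} (k : ℕ) (S : Finset (Fin N)) (a : ℝ) :
    eval (flat S a) (T (k + 3) N) = flatT k #S a := by
  induction k with
  | zero =>
    rw [zero_add, T_three, flatT]
    simp only [map_add, map_sub, map_mul, map_pow, map_one, map_ofNat, eval_flat_esymm]
    simp
  | succ k ih =>
    rw [T_succ, flatT, map_sub, map_mul, eval_C, ih, eval_flat_esymm]

theorem r_succ (k : ℕ) :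
    r (k + 4) = ((k + 4 : ℕ) : ℝ) ^ (k + 4) * (flatT k (k + 4) (1 / (k + 4 : ℕ)) + 1) := by
  have h : (fun _ : Fin (k + 4) => 1 / ((k + 4 : ℕ) : ℝ)) = flat univ (1 / (k + 4 : ℕ)) := by
    funext i
    simp [flat]
  rw [r, nextR, h, eval_flat_T, card_univ, Fintype.card_fin]

/-- `T_(k+3)` takes the values `±1` with alternating signs at the barycenters of the faces. -/
theorem flatT_inv (k j : ℕ) (hj : 1 ≤ j) (hjk : j ≤ k + 3) :
    flatT k j (1 / j) = (-1) ^ (k + 3 + j) := by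
  induction k with
  | zero =>
    have : j = 1 ∨ j = 2 ∨ j = 3 := by omega
    rcases this with rfl | rfl | rfl <;> norm_num [flatT, Nat.choose]
  | succ k ih =>
    rcases Nat.lt_or_ge j (k + 4) with h | h
    · rw [flatT, Nat.choose_eq_zero_of_lt h, ih (by omega)]
      push_cast
      ring
    · obtain rfl : j = k + 4 := by omega
      have h0 : ((k + 4 : ℕ) : ℝ) ≠ 0 := by positivity
      rw [flatT, r_succ, Nat.choose_self, show k + 1 + 3 + (k + 4) = 2 * (k + 4) by ring, pow_mul,
        one_div, inv_pow]
      field_simp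
      norm_num

/-! ### The alternating functional on the barycenters of the faces -/

/-- The closed form `k ∑_i (k choose i) i^(k-1)` of the constants `r_k`. -/
noncomputable def rSum (k : ℕ) : ℝ := k * ∑ i ∈ range (k + 1), k.choose i * (i : ℝ) ^ (k - 1)

theorem rSum_pos {d : ℕ} (hd : 1 ≤ d) : 0 < rSum d := by
  have h0 : (0 : ℝ) < d := by exact_mod_cast hd
  refine mul_pos h0 (sum_pos' (fun i _ => by positivity) ⟨d, by simp, ?_⟩)
  rw [Nat.choose_self]
  positivity

theorem sum_card_pow (d m : ℕ) :
    ∑ S : Finset (Fin d), (#S : ℝ) ^ m = ∑ i ∈ range (d + 1), d.choose i * (i : ℝ) ^ m := by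
  rw [← powerset_univ, sum_powerset_apply_card fun i : ℕ => (i : ℝ) ^ m]
  simp

theorem sum_alternating_choose_mul_pow {m n : ℕ} (h : m < n) (c : ℝ) :
    ∑ k ∈ range (n + 1), (-1 : ℝ) ^ k * n.choose k * (c + k) ^ m = 0 := by
  have h1 := congr_fun (fwdDiff_iter_pow_eq_zero_of_lt (R := ℝ) h) c
  rw [fwdDiff_iter_eq_sum_shift] at h1
  have h2 : ∀ k ∈ range (n + 1), (-1 : ℝ) ^ k * n.choose k * (c + k) ^ m =
      (-1) ^ n * (((-1 : ℤ) ^ (n - k) * n.choose k) • (c + k • (1 : ℝ)) ^ m) := by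
    intro k hk
    have hk' : k ≤ n := by simpa [Nat.lt_succ_iff] using hk
    obtain ⟨l, rfl⟩ := Nat.exists_eq_add_of_le hk'
    have hl : (-1 : ℝ) ^ (k + l) * (-1) ^ l = (-1) ^ k := by
      rw [pow_add, mul_assoc, ← mul_pow]
      simp
    rw [Nat.add_sub_cancel_left, zsmul_eq_mul, ← hl]
    push_cast
    simp only [nsmul_eq_mul, mul_one]
    ring
  rw [sum_congr rfl h2, ← mul_sum, h1]
  simp

theorem sum_alternating_card_pow {d m : ℕ} (A : Finset (Fin d)) (h : m + #A < d) :
    ∑ S : Finset (Fin d), (-1 : ℝ) ^ #S * (if A ⊆ S then (#S : ℝ) ^ m else 0) = 0 := by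
  have hAc : #Aᶜ = d - #A := by rw [card_compl, Fintype.card_fin]
  have h1 : ∑ S : Finset (Fin d), (-1 : ℝ) ^ #S * (if A ⊆ S then (#S : ℝ) ^ m else 0) =
      ∑ T ∈ Aᶜ.powerset, (-1 : ℝ) ^ (#A + #T) * ((#A : ℝ) + #T) ^ m := by
    simp only [mul_ite, mul_zero]
    rw [← sum_filter]
    refine sum_nbij' (fun S => S \ A) (fun T => A ∪ T) ?_ ?_ ?_ ?_ ?_
    · intro S _
      rw [mem_powerset]
      intro i
      simp
    · intro T _
      simp
    · intro S hS
      rw [mem_filter] at hS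
      exact union_sdiff_of_subset hS.2
    · intro T hT
      rw [mem_powerset, subset_compl_iff_disjoint_left] at hT
      exact union_sdiff_cancel_left hT
    · intro S hS
      rw [mem_filter] at hS
      rw [← Nat.cast_add, add_comm #A, card_sdiff_add_card_eq_card hS.2]
  rw [h1, sum_powerset_apply_card fun k : ℕ => (-1 : ℝ) ^ (#A + k) * ((#A : ℝ) + k) ^ m]
  have h2 := sum_alternating_choose_mul_pow (m := m) (n := #Aᶜ) (by omega) #A
  rw [← mul_zero ((-1 : ℝ) ^ #A), ← h2, mul_sum]
  refine sum_congr rfl fun k _ => ?_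
  rw [nsmul_eq_mul, pow_add]
  ring

theorem prod_flat_pow {d : ℕ} (S : Finset (Fin d)) (a : ℝ) (m : Fin d →₀ ℕ) :
    ∏ i, flat S a i ^ m i = if m.support ⊆ S then a ^ m.degree else 0 := by
  split_ifs with h
  · rw [Finsupp.degree_apply, ← prod_pow_eq_pow_sum, ← prod_subset (subset_univ m.support)]
    · exact prod_congr rfl fun i hi => by simp [flat, h hi]
    · intro i _ hi
      simp [Finsupp.notMem_support_iff.1 hi]
  · obtain ⟨i, hi, hiS⟩ := not_subset.1 h
    refine prod_eq_zero (mem_univ i) ?_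
    simpa [flat, hiS] using hi

/-- The alternating sum over the barycenters of the faces of a simplex, weighted by the `(d-1)`-st
powers of their numbers of vertices, vanishes on polynomials of degree less than `d`. After
homogenization this is the polarization identity. -/
theorem sum_alternating_eval_eq_zero {d : ℕ} (hd : 2 ≤ d) (p : MvPolynomial (Fin d) ℝ)
    (hp : p.totalDegree ≤ d - 1) :
    ∑ S : Finset (Fin d), (-1 : ℝ) ^ #S * ((#S : ℝ) ^ (d - 1) * eval (flat S (1 / #S)) p) = 0 := by
  simp only [eval_eq', mul_sum]
  rw [sum_comm]
  refine sum_eq_zero fun m hm => ?_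
  have hm1 : m.degree ≤ d - 1 := (le_totalDegree hm).trans hp
  have hm2 : #m.support ≤ m.degree := by
    rw [Finsupp.degree_apply, card_eq_sum_ones]
    exact sum_le_sum fun i hi => Nat.one_le_iff_ne_zero.2 (Finsupp.mem_support_iff.1 hi)
  rw [← mul_zero (coeff m p),
    ← sum_alternating_card_pow (d := d) (m := d - 1 - m.degree) m.support (by omega), mul_sum]
  refine sum_congr rfl fun S _ => ?_
  rw [prod_flat_pow]
  split_ifs with h
  · have h2 : (#S : ℝ) ^ (d - 1) * (1 / #S) ^ m.degree = (#S : ℝ) ^ (d - 1 - m.degree) := by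
      rcases Nat.eq_zero_or_pos #S with h0 | h0
      · have hdeg : m.degree = 0 := by
          rw [card_eq_zero] at h0
          rw [h0, subset_empty, Finsupp.support_eq_empty] at h
          simp [h]
        simp [hdeg]
      · have h0' : (#S : ℝ) ≠ 0 := by positivity
        rw [← Nat.sub_add_cancel hm1, Nat.add_sub_cancel, pow_add, mul_assoc, ← mul_pow,
          mul_one_div_cancel h0', one_pow, mul_one]
    rw [← h2]
    ring
  · ring

theorem sum_alternating_prod {d : ℕ} (hd : 1 ≤ d) :
    ∑ S : Finset (Fin d), (-1 : ℝ) ^ #S * ((#S : ℝ) ^ (d - 1) * ∏ i, flat S (1 / #S) i) =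
      (-1) ^ d / d := by
  rw [sum_eq_single univ]
  · have h0 : (d : ℝ) ≠ 0 := by positivity
    obtain ⟨e, rfl⟩ : ∃ e, d = e + 1 := ⟨d - 1, by omega⟩
    simp only [flat, mem_univ, if_true, prod_const, card_univ, Fintype.card_fin,
      Nat.add_sub_cancel]
    rw [one_div, inv_pow]
    field_simp
    rw [pow_succ]
  · intro S _ hS
    obtain ⟨i, hi⟩ : ∃ i, i ∉ S := by simpa [eq_univ_iff_forall] using hS
    rw [prod_eq_zero (mem_univ i) (by simp [flat, hi])]
    ring
  · simp

theorem r_eq_rSum {d : ℕ} (hd : 3 ≤ d) : r d = rSum d := by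
  obtain ⟨k, rfl⟩ : ∃ k, d = k + 3 := ⟨d - 3, by omega⟩
  obtain ⟨p, hp, hT⟩ := exists_T_eq k (k + 3)
  have h1 : ∀ S : Finset (Fin (k + 3)),
      (-1 : ℝ) ^ #S * ((#S : ℝ) ^ (k + 3 - 1) * eval (flat S (1 / #S)) (T (k + 3) (k + 3))) =
        (-1) ^ (k + 3) * (#S : ℝ) ^ (k + 3 - 1) := by
    intro S
    rcases Nat.eq_zero_or_pos #S with h0 | h0
    · rw [h0]
      simp
    · have hS : #S ≤ k + 3 := by simpa using card_le_univ S
      have h2 : (-1 : ℝ) ^ #S * (-1) ^ #S = 1 := by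
        rw [← mul_pow]
        simp
      rw [eval_flat_T, flatT_inv _ _ h0 hS, pow_add _ (k + 3)]
      linear_combination ((-1) ^ (k + 3) * (#S : ℝ) ^ (k + 3 - 1)) * h2
  have h2 := sum_congr rfl fun S (_ : S ∈ (univ : Finset (Finset (Fin (k + 3))))) => h1 S
  rw [← mul_sum, sum_card_pow, hT] at h2
  simp only [map_add, map_mul, eval_C, eval_esymm_card, mul_add, sum_add_distrib] at h2
  rw [sum_alternating_eval_eq_zero (by omega) p (by omega), add_zero] at h2
  have h3 := sum_alternating_prod (d := k + 3) (by omega)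
  have h4 : r (k + 3) * ((-1) ^ (k + 3) / (k + 3 : ℕ)) = (-1) ^ (k + 3) *
      ∑ i ∈ range (k + 3 + 1), ((k + 3).choose i : ℝ) * (i : ℝ) ^ (k + 3 - 1) := by
    rw [← h2, ← h3, mul_sum]
    exact sum_congr rfl fun S _ => by ring
  have h5 : ((-1 : ℝ) ^ (k + 3)) ≠ 0 := by simp
  have h6 : ((k + 3 : ℕ) : ℝ) ≠ 0 := by positivity
  rw [rSum]
  rw [mul_div_assoc', div_eq_iff h6] at h4
  refine mul_right_cancel₀ h5 (h4.trans ?_)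
  ring

theorem r_pos {d : ℕ} (hd : 3 ≤ d) : 0 < r d := r_eq_rSum hd ▸ rSum_pos (by omega)

/-- Every polynomial of degree less than `d` differs from `x_1 ⋯ x_d` by at least `r_d⁻¹` at some
point of the face `x_1 + ⋯ + x_d = 1` of the simplex. -/
theorem exists_inv_r_le {d : ℕ} (hd : 3 ≤ d) (p : MvPolynomial (Fin d) ℝ)
    (hp : p.totalDegree ≤ d - 1) :
    ∃ x : Fin d → ℝ, (∀ i, 0 ≤ x i) ∧ ∑ i, x i = 1 ∧ (r d)⁻¹ ≤ |∏ i, x i - eval x p| := by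
  have hd0 : (d : ℝ) ≠ 0 := by positivity
  have hL : ∑ S : Finset (Fin d), (-1 : ℝ) ^ #S *
      ((#S : ℝ) ^ (d - 1) * (∏ i, flat S (1 / #S) i - eval (flat S (1 / #S)) p)) =
        (-1) ^ d / d := by
    simp only [mul_sub, sum_sub_distrib]
    rw [sum_alternating_eval_eq_zero (by omega) p hp, sub_zero, sum_alternating_prod (by omega)]
  have hM : ∑ S : Finset (Fin d), (#S : ℝ) ^ (d - 1) * (r d)⁻¹ = 1 / d := by
    have hr := (r_pos hd).ne'
    rw [← sum_mul, sum_card_pow]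
    rw [r_eq_rSum hd] at hr ⊢
    rw [rSum] at hr ⊢
    have := right_ne_zero_of_mul hr
    field_simp
  have hle : ∑ S : Finset (Fin d), (#S : ℝ) ^ (d - 1) * (r d)⁻¹ ≤ ∑ S : Finset (Fin d),
      (#S : ℝ) ^ (d - 1) * |∏ i, flat S (1 / #S) i - eval (flat S (1 / #S)) p| := by
    rw [hM]
    calc (1 : ℝ) / d = |(-1) ^ d / (d : ℝ)| := by simp [abs_div]
      _ ≤ _ := by
        rw [← hL]
        refine (abs_sum_le_sum_abs _ _).trans (sum_le_sum fun S _ => ?_)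
        simp [abs_mul]
  -- The empty set has weight zero, so only nonempty sets matter.
  rw [← sum_subset (subset_univ (univ.filter fun S : Finset (Fin d) => S.Nonempty)),
    ← sum_subset (subset_univ (univ.filter fun S : Finset (Fin d) => S.Nonempty))] at hle
  · obtain ⟨S, hS, h⟩ := exists_le_of_sum_le ⟨{⟨0, by omega⟩}, by simp⟩ hle
    have hS0 : 0 < #S := card_pos.2 (mem_filter.1 hS).2
    refine ⟨flat S (1 / #S), fun i => ?_, ?_, le_of_mul_le_mul_left h (by positivity)⟩
    · simp only [flat]
      split_ifs <;> positivity
    · rw [sum_flat]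
      field_simp
  all_goals
    intro S _ hS
    have hS' : S = ∅ := by simpa using hS
    simp [hS', show d - 1 ≠ 0 by omega]

/-! ### Abel's identity and the extremal polynomial on the simplex -/

/-- The weight `w_i = (is)^i ((1 - is)^(j-i) - (j-i) s (1 - is)^(j-i-1))`. For `i < j` it is
`(is)^i (1 - is)^(j-i-1) (1 - js)`, and `(j choose i) w_i` are the probabilities of Abel's
(quasi-binomial) distribution. -/
noncomputable def abelWeight (j i : ℕ) (s : ℝ) : ℝ :=
  (i * s) ^ i * ((1 - i * s) ^ (j - i) - (j - i : ℕ) * s * (1 - i * s) ^ (j - i - 1))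

theorem abelWeight_nonneg {j i : ℕ} (hij : i ≤ j) {s : ℝ} (hs : 0 ≤ s) (hjs : j * s ≤ 1) :
    0 ≤ abelWeight j i s := by
  obtain ⟨n, rfl⟩ := Nat.exists_eq_add_of_le hij
  rw [abelWeight, Nat.add_sub_cancel_left]
  refine mul_nonneg (by positivity) ?_
  rcases n with _ | m
  · simp
  · push_cast at hjs
    have h1 : (0 : ℝ) ≤ m * s := by positivity
    have h2 : 0 ≤ 1 - i * s := by linarith
    rw [Nat.add_sub_cancel, pow_succ,
      show (1 - i * s) ^ m * (1 - i * s) - ((m + 1 : ℕ) : ℝ) * s * (1 - i * s) ^ m =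
        (1 - i * s) ^ m * (1 - (i + (m + 1)) * s) by push_cast; ring]
    exact mul_nonneg (pow_nonneg h2 m) (by linarith)

theorem sum_mul_choose_mul_pow (n : ℕ) (y : ℝ) :
    ∑ m ∈ range (n + 1), (m : ℝ) * n.choose m * y ^ m = n * y * (1 + y) ^ (n - 1) := by
  rcases n with _ | n
  · simp
  · rw [sum_range_succ', Nat.add_sub_cancel, add_comm 1 y, add_pow]
    simp only [one_pow, mul_one, Nat.cast_zero, zero_mul, add_zero, mul_sum]
    refine sum_congr rfl fun m _ => ?_
    have h : ((m + 1 : ℕ) : ℝ) * (n + 1).choose (m + 1) = (n + 1 : ℕ) * n.choose m := by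
      rw [mul_comm]
      exact_mod_cast (Nat.add_one_mul_choose_eq n m).symm
    rw [h]
    ring

theorem choose_mul_abelWeight {j i : ℕ} (hi : 1 ≤ i) (hij : i ≤ j) (s : ℝ) :
    j.choose i * abelWeight j i s = ∑ k ∈ range (j + 1),
      j.choose k * (-s) ^ k * k * ((-1) ^ i * k.choose i * (i : ℝ) ^ (k - 1)) := by
  obtain ⟨n, rfl⟩ := Nat.exists_eq_add_of_le hij
  have hi0 : (i : ℝ) ≠ 0 := by positivity
  have h1 : i * abelWeight (i + n) i s =
      (i * s) ^ i * ∑ m ∈ range (n + 1), ((i : ℝ) + m) * n.choose m * (-(i * s)) ^ m := by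
    have hadd : (1 - (i : ℝ) * s) ^ n = ∑ m ∈ range (n + 1), (n.choose m : ℝ) * (-(i * s)) ^ m := by
      rw [sub_eq_neg_add, add_pow]
      refine sum_congr rfl fun m _ => ?_
      rw [one_pow]
      ring
    have hder := sum_mul_choose_mul_pow n (-(i * s))
    simp only [add_mul, sum_add_distrib, hder]
    simp only [mul_assoc, ← mul_sum]
    rw [← hadd, abelWeight, Nat.add_sub_cancel_left]
    ring
  rw [add_assoc, sum_range_add, sum_eq_zero, zero_add]
  · refine mul_left_cancel₀ hi0 ?_
    rw [mul_left_comm, h1, mul_sum, mul_sum, mul_sum]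
    refine sum_congr rfl fun m _ => ?_
    have hch : ((i + n).choose (i + m) : ℝ) * (i + m).choose i = (i + n).choose i * n.choose m := by
      have := Nat.choose_mul (n := i + n) (k := i + m) (s := i) (by omega)
      rw [Nat.add_sub_cancel_left, Nat.add_sub_cancel_left] at this
      exact_mod_cast this
    have hpow : (i : ℝ) ^ (i + m) = i ^ (i + m - 1) * i := by
      rw [← pow_succ, Nat.sub_add_cancel (by omega)]
    have hsign : (-1 : ℝ) ^ i * (-1) ^ i = 1 := by
      rw [← mul_pow]
      simp
    calc _ = ((i + n).choose i * n.choose m : ℝ) * (i + m : ℝ) * (-1) ^ m * s ^ (i + m)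
          * i ^ (i + m) := by
          rw [neg_pow, mul_pow, mul_pow, pow_add, pow_add]
          ring
      _ = _ := by
          rw [← hch, hpow, neg_pow s, pow_add (-1)]
          push_cast
          linear_combination (-((i + n).choose (i + m) * (i + m).choose i * (i + m : ℝ) * (-1) ^ m
            * s ^ (i + m) * (i ^ (i + m - 1) * i))) * hsign
  · intro k hk
    rw [Nat.choose_eq_zero_of_lt (mem_range.1 hk)]
    simp

theorem sum_pow_mul_choose_mul_abelWeight (j : ℕ) (ε s : ℝ) :
    ∑ i ∈ range (j + 1), ε ^ i * (j.choose i * abelWeight j i s) =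
      1 + ∑ k ∈ range (j + 1), j.choose k * (-s) ^ k * k *
        ∑ i ∈ range (k + 1), (-ε) ^ i * k.choose i * (i : ℝ) ^ (k - 1) := by
  have hext : ∀ k ∈ range (j + 1),
      ∑ i ∈ range (k + 1), (-ε) ^ i * k.choose i * (i : ℝ) ^ (k - 1) =
        ∑ i ∈ range (j + 1), (-ε) ^ i * k.choose i * (i : ℝ) ^ (k - 1) := by
    intro k hk
    refine sum_subset (range_mono (by simpa using hk)) fun i _ hi => ?_
    rw [Nat.choose_eq_zero_of_lt (by simpa using hi)]
    simp
  have hswap : ∑ k ∈ range (j + 1), j.choose k * (-s) ^ k * k *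
      ∑ i ∈ range (k + 1), (-ε) ^ i * k.choose i * (i : ℝ) ^ (k - 1) =
        ∑ i ∈ range (j + 1), ∑ k ∈ range (j + 1), j.choose k * (-s) ^ k * k *
          ((-ε) ^ i * k.choose i * (i : ℝ) ^ (k - 1)) := by
    rw [sum_comm]
    exact sum_congr rfl fun k hk => by rw [hext k hk, mul_sum]
  rw [hswap, sum_range_succ' (fun i => ε ^ i * (j.choose i * abelWeight j i s)) j,
    sum_range_succ' (fun i => ∑ k ∈ range (j + 1), j.choose k * (-s) ^ k * k *
      ((-ε) ^ i * k.choose i * (i : ℝ) ^ (k - 1))) j, add_comm 1, add_assoc]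
  congr 1
  · refine sum_congr rfl fun i hi => ?_
    rw [choose_mul_abelWeight (by omega) (by simpa using hi), mul_sum]
    refine sum_congr rfl fun k _ => ?_
    rw [neg_pow ε]
    ring
  · -- For `i = 0` only `k = 1` contributes, through `0 ^ 0 = 1`.
    rcases j with _ | j
    · simp [abelWeight]
    · rw [sum_eq_single 1]
      · simp [abelWeight]
        ring
      · intro k _ hk
        rcases Nat.eq_zero_or_pos k with h0 | h0
        · simp [h0]
        · simp [show k - 1 ≠ 0 by omega]
      · simp

theorem sum_choose_mul_abelWeight (j : ℕ) (s : ℝ) :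
    ∑ i ∈ range (j + 1), j.choose i * abelWeight j i s = 1 := by
  have h := sum_pow_mul_choose_mul_abelWeight j 1 s
  simp only [one_pow, one_mul] at h
  rw [h, add_eq_left]
  refine sum_eq_zero fun k _ => ?_
  rcases Nat.eq_zero_or_pos k with h0 | h0
  · simp [h0]
  · have h1 := sum_alternating_choose_mul_pow (m := k - 1) (n := k) (by omega) 0
    simp only [zero_add] at h1
    rw [h1, mul_zero]

/-- The left-hand side is the alternating sum of the probabilities `(j choose i) w_i`. -/
theorem abs_one_add_sum_rSum_le {j : ℕ} {s : ℝ} (hs : 0 ≤ s) (hjs : j * s ≤ 1) :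
    |1 + ∑ k ∈ range (j + 1), (-1) ^ k * rSum k * (j.choose k * s ^ k)| ≤ 1 := by
  have h := sum_pow_mul_choose_mul_abelWeight j (-1) s
  simp only [neg_neg, one_pow, one_mul] at h
  rw [sum_congr rfl fun k _ => show (-1) ^ k * rSum k * (j.choose k * s ^ k) =
    j.choose k * (-s) ^ k * k * ∑ i ∈ range (k + 1), k.choose i * (i : ℝ) ^ (k - 1) by
      rw [rSum, neg_pow s]; ring, ← h]
  refine (abs_sum_le_sum_abs _ _).trans
    ((sum_le_sum fun i hi => ?_).trans_eq (sum_choose_mul_abelWeight j s))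
  have h0 := abelWeight_nonneg (i := i) (by simpa [Nat.lt_succ_iff] using hi) hs hjs
  rw [abs_mul, abs_pow, abs_neg, abs_one, one_pow, one_mul, abs_of_nonneg (by positivity)]

/-- The bound `|G| ≤ 1` on the simplex can be checked at points whose nonzero coordinates are
equal. -/
theorem abs_eval_le_one_of_flat {d : ℕ} (G : MvPolynomial (Fin d) ℝ)
    (hG : IsPairAffine fun x => eval x G)
    (hflat : ∀ (S : Finset (Fin d)) (a : ℝ), 0 ≤ a → #S * a ≤ 1 → |eval (flat S a) G| ≤ 1)
    {x : Fin d → ℝ} (hx : x ∈ simplex d) : |eval x G| ≤ 1 := by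
  have hc : Continuous fun x => eval x G := MvPolynomial.continuous_eval G
  obtain ⟨S, a, ha, hS, h⟩ := hG.exists_flat_le hc x hx.1
  obtain ⟨S', a', ha', hS', h'⟩ := hG.neg.exists_flat_le hc.neg x hx.1
  have h1 := (abs_le.1 (hflat S a ha (hS.trans_le hx.2))).2
  have h2 := (abs_le.1 (hflat S' a' ha' (hS'.trans_le hx.2))).1
  exact abs_le.2 ⟨by linarith, by linarith⟩

/-- The polynomial `(-1)^d (1 - 2 e_1 + 8 e_2 + ∑_{k ≥ 3} (-1)^k r_k e_k)`. On the hyperplane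
`x_1 + ⋯ + x_d = 1` it agrees with `T_d`. The coefficients are given by the closed form `rSum`, for
which `rSum 1 = 2` and `rSum 2 = 8`. -/
noncomputable def extremal (d : ℕ) : MvPolynomial (Fin d) ℝ :=
  C ((-1) ^ d) * (1 + ∑ k ∈ range (d + 1), C ((-1) ^ k * rSum k) * esymm (Fin d) ℝ k)

theorem eval_extremal {d : ℕ} (x : Fin d → ℝ) : eval x (extremal d) =
    (-1) ^ d * (1 + ∑ k ∈ range (d + 1), (-1) ^ k * rSum k * eval x (esymm (Fin d) ℝ k)) := by
  simp [extremal]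

theorem abs_eval_extremal_le {d : ℕ} {x : Fin d → ℝ} (hx : x ∈ simplex d) :
    |eval x (extremal d)| ≤ 1 := by
  refine abs_eval_le_one_of_flat _ ?_ (fun S a ha hS => ?_) hx
  · simp only [eval_extremal]
    refine IsPairAffine.const_mul (IsPairAffine.add (isPairAffine_comp_sum fun _ => 1) ?_) _
    induction range (d + 1) using Finset.induction_on with
    | empty => simpa using isPairAffine_comp_sum fun _ => 0
    | insert k s hk ih =>
      simp only [sum_insert hk]
      exact ((isPairAffine_esymm d k).const_mul _).add ih
  · have hSd : #S ≤ d := by simpa using card_le_univ S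
    rw [eval_extremal, abs_mul, abs_pow, abs_neg, abs_one, one_pow, one_mul]
    simp only [eval_flat_esymm]
    rw [← sum_subset (range_mono (Nat.succ_le_succ hSd))]
    · exact abs_one_add_sum_rSum_le ha hS
    · intro k _ hk
      rw [Nat.choose_eq_zero_of_lt (by simpa using hk)]
      simp

theorem exists_extremal_eq {d : ℕ} (hd : 3 ≤ d) : ∃ p : MvPolynomial (Fin d) ℝ,
    p.totalDegree ≤ d - 1 ∧ extremal d = C (r d) * esymm (Fin d) ℝ d + p := by
  refine ⟨C ((-1) ^ d) * (1 + ∑ k ∈ range d, C ((-1) ^ k * rSum k) * esymm (Fin d) ℝ k), ?_, ?_⟩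
  · refine (totalDegree_C_mul_le _ _).trans ((totalDegree_add _ _).trans (max_le (by simp) ?_))
    refine totalDegree_finsetSum_le fun k hk => ?_
    have hk' := mem_range.1 hk
    exact (totalDegree_C_mul_le _ _).trans ((totalDegree_esymm_le _ _).trans (by omega))
  · have h : (C ((-1) ^ d) * C ((-1) ^ d) : MvPolynomial (Fin d) ℝ) = 1 := by
      rw [← map_mul, ← mul_pow]
      simp
    rw [extremal, sum_range_succ, r_eq_rSum hd, map_mul]
    linear_combination (C (rSum d) * esymm (Fin d) ℝ d) * h

/-! ### The polynomials `T_3`, `T_4`, `T_5` on the simplex -/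

theorem isPairAffine_T (k N : ℕ) : IsPairAffine fun x => eval x (T (k + 3) N) := by
  induction k with
  | zero =>
    have h := (((isPairAffine_esymm N 3).const_mul 72).add
      ((isPairAffine_esymm N 2).const_mul (-8))).add
        (isPairAffine_comp_sum fun s => -4 * s + 4 * s ^ 2 + 1)
    convert h using 2 with x
    rw [zero_add, T_three, ← eval_esymm_one]
    simp only [map_add, map_sub, map_mul, map_pow, map_one, map_ofNat]
    ring
  | succ k ih =>
    convert ((isPairAffine_esymm N (k + 4)).const_mul (r (k + 4))).add ih.neg using 2 with x
    rw [T_succ, map_sub, map_mul, eval_C, sub_eq_add_neg]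

/-- The squares offered to `nlinarith` here and in the next two lemmas are centered near the minimum
of the polynomial at hand. For the largest `j` the upper bound comes from splitting off the factor
`1 - j a`, since the value at `a = 1/j` is one. -/
theorem abs_flatT_zero_le {j : ℕ} (hj : j ≤ 3) {a : ℝ} (ha : 0 ≤ a) (hja : j * a ≤ 1) :
    |flatT 0 j a| ≤ 1 := by
  rw [flatT, abs_le]
  interval_cases j <;> norm_num [Nat.choose] at hja ⊢
  · constructor <;> nlinarith [sq_nonneg (2 * a - 1)]
  · constructor <;> nlinarith [sq_nonneg (2 * a - 1)]
  · constructor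
    · nlinarith [mul_nonneg ha (sq_nonneg (a - 3 / 16)), sq_nonneg (a - 3 / 16)]
    · nlinarith [mul_nonneg (mul_nonneg ha (sub_nonneg.2 hja)) (by positivity : 0 ≤ 1 + 2 * a)]

theorem abs_flatT_one_le {j : ℕ} (hj : j ≤ 4) {a : ℝ} (ha : 0 ≤ a) (hja : j * a ≤ 1) :
    |flatT 1 j a| ≤ 1 := by
  rcases Nat.lt_or_ge j 4 with h | h
  · rw [flatT, Nat.choose_eq_zero_of_lt h]
    simpa using abs_flatT_zero_le (by omega) ha hja
  · obtain rfl : j = 4 := by omega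
    have h4 : r 4 = 896 := by
      rw [r_eq_rSum (by norm_num), rSum]
      norm_num [sum_range_succ, Nat.choose]
    norm_num [Nat.choose] at hja
    norm_num [flatT, Nat.choose, h4, abs_le]
    constructor
    · have h1 : 0 ≤ 56 * a ^ 3 - 18 * a ^ 2 - a + 1 := by
        nlinarith [mul_nonneg ha (sq_nonneg (a - 3 / 16)), sq_nonneg (a - 3 / 16)]
      nlinarith [mul_nonneg ha h1]
    · have h1 : 0 ≤ 2 - 8 * a - 16 * a ^ 2 + 224 * a ^ 3 := by
        nlinarith [mul_nonneg ha (sq_nonneg (a - 1 / 8)), sq_nonneg (a - 1 / 8)]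
      nlinarith [mul_nonneg (sub_nonneg.2 hja) h1]

theorem abs_flatT_two_le {j : ℕ} (hj : j ≤ 5) {a : ℝ} (ha : 0 ≤ a) (hja : j * a ≤ 1) :
    |flatT 2 j a| ≤ 1 := by
  rcases Nat.lt_or_ge j 5 with h | h
  · rw [flatT, Nat.choose_eq_zero_of_lt h]
    simpa using abs_flatT_one_le (by omega) ha hja
  · obtain rfl : j = 5 := by omega
    have h4 : r 4 = 896 := by
      rw [r_eq_rSum (by norm_num), rSum]
      norm_num [sum_range_succ, Nat.choose]
    have h5 : r 5 = 14400 := by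
      rw [r_eq_rSum (by norm_num), rSum]
      norm_num [sum_range_succ, Nat.choose]
    norm_num [Nat.choose] at hja
    norm_num [flatT, Nat.choose, h4, h5, abs_le]
    constructor
    · -- The part of degree at least three is `a ^ 3 (720 - 4480 a + 14400 a ^ 2) ≥ 370 a ^ 3`.
      have h1 : 0 ≤ 2 - 20 * a + 20 * a ^ 2 + 370 * a ^ 3 := by
        nlinarith [mul_nonneg ha (sq_nonneg (a - 23 / 200)), sq_nonneg (a - 23 / 200)]
      have h2 : 0 ≤ 350 - 4480 * a + 14400 * a ^ 2 := by
        nlinarith [sq_nonneg (a - 7 / 45)]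
      nlinarith [mul_nonneg (pow_nonneg ha 3) h2]
    · have h1 : 0 ≤ 1 + 4 * a - 16 * a ^ 2 + 144 * a ^ 3 := by
        nlinarith [mul_nonneg ha (sub_nonneg.2 hja), pow_nonneg ha 3]
      nlinarith [mul_nonneg (mul_nonneg ha (sub_nonneg.2 hja)) h1]

theorem abs_eval_T_le {d : ℕ} (hd : d = 3 ∨ d = 4 ∨ d = 5) {x : Fin d → ℝ} (hx : x ∈ simplex d) :
    |eval x (T d d)| ≤ 1 := by
  have hSd : ∀ S : Finset (Fin d), #S ≤ d := fun S => by simpa using card_le_univ S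
  rcases hd with rfl | rfl | rfl
  · refine abs_eval_le_one_of_flat _ (isPairAffine_T 0 _) (fun S a ha hS => ?_) hx
    rw [eval_flat_T 0]
    exact abs_flatT_zero_le (hSd S) ha hS
  · refine abs_eval_le_one_of_flat _ (isPairAffine_T 1 _) (fun S a ha hS => ?_) hx
    rw [eval_flat_T 1]
    exact abs_flatT_one_le (hSd S) ha hS
  · refine abs_eval_le_one_of_flat _ (isPairAffine_T 2 _) (fun S a ha hS => ?_) hx
    rw [eval_flat_T 2]
    exact abs_flatT_two_le (hSd S) ha hS

/-! ### Best approximation from matching bounds -/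

theorem le_supNorm {N : ℕ} {Ω : Set (Fin N → ℝ)} (hΩ : IsCompact Ω) {g : (Fin N → ℝ) → ℝ}
    (hg : Continuous g) {x : Fin N → ℝ} (hx : x ∈ Ω) : |g x| ≤ supNorm Ω g :=
  le_csSup (hΩ.image (continuous_abs.comp hg)).bddAbove ⟨x, hx, rfl⟩

theorem supNorm_le {N : ℕ} {Ω : Set (Fin N → ℝ)} {g : (Fin N → ℝ) → ℝ} {E : ℝ} (hE : 0 ≤ E)
    (h : ∀ x ∈ Ω, |g x| ≤ E) : supNorm Ω g ≤ E := by
  refine Real.sSup_le ?_ hE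
  rintro _ ⟨x, hx, rfl⟩
  exact h x hx

theorem bestApprox_eq_and_isLeastDeviation {N n : ℕ} {f g : (Fin N → ℝ) → ℝ}
    {Ω : Set (Fin N → ℝ)} {E : ℝ} (hΩ : IsCompact Ω) (hf : Continuous f) (hE : 0 ≤ E)
    (hlow : ∀ p : MvPolynomial (Fin N) ℝ, p.totalDegree ≤ n → ∃ x ∈ Ω, E ≤ |f x - eval x p|)
    (hg : ∃ p : MvPolynomial (Fin N) ℝ, p.totalDegree ≤ n ∧ ∀ x, g x = f x - eval x p)
    (hle : ∀ x ∈ Ω, |g x| ≤ E) : bestApprox n f Ω = E ∧ IsLeastDeviation n f Ω g := by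
  have hlow' : ∀ p : MvPolynomial (Fin N) ℝ, p.totalDegree ≤ n →
      E ≤ supNorm Ω fun x => f x - eval x p := by
    intro p hp
    obtain ⟨x, hx, h⟩ := hlow p hp
    exact h.trans (le_supNorm hΩ (hf.sub (MvPolynomial.continuous_eval p)) hx)
  obtain ⟨q, hq, hgq⟩ := hg
  have hsup : supNorm Ω g = E := by
    refine le_antisymm (supNorm_le hE hle) ?_
    rw [funext hgq]
    exact hlow' q hq
  have hbest : bestApprox n f Ω = E := by
    refine IsLeast.csInf_eq ⟨⟨q, hq, ?_⟩, ?_⟩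
    · rw [← hsup, funext hgq]
    · rintro _ ⟨p, hp, rfl⟩
      exact hlow' p hp
  exact ⟨hbest, q, hq, hgq, hsup.trans hbest.symm⟩

/-! ### The simplex, its face, the ball and the sphere -/

theorem isCompact_simplex (N : ℕ) : IsCompact (simplex N) := by
  have hcl : IsClosed (simplex N) := by
    have h1 : IsClosed {y : Fin N → ℝ | ∀ i, 0 ≤ y i} := by
      simp only [Set.ofPred_forall]
      exact isClosed_iInter fun i => isClosed_le continuous_const (continuous_apply i)
    exact h1.inter (isClosed_le (continuous_finsetSum _ fun i _ => continuous_apply i)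
      continuous_const)
  refine (isCompact_Icc (a := (0 : Fin N → ℝ)) (b := fun _ => 1)).of_isClosed_subset hcl ?_
  intro y hy
  exact ⟨fun i => hy.1 i, fun i => (single_le_sum (fun k _ => hy.1 k) (mem_univ i)).trans hy.2⟩

theorem mem_ball_iff {N : ℕ} {x : Fin N → ℝ} : x ∈ ball N ↔ ∑ i, x i ^ 2 ≤ 1 := by
  simp [ball, EuclideanSpace.norm_eq, Real.sqrt_le_iff]

theorem mem_sphere_iff {N : ℕ} {x : Fin N → ℝ} : x ∈ sphere N ↔ ∑ i, x i ^ 2 = 1 := by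
  simp [sphere, EuclideanSpace.norm_eq, Real.sqrt_eq_one]

theorem sphere_subset_ball (N : ℕ) : sphere N ⊆ ball N := fun _ hx => le_of_eq hx

theorem isCompact_ball (N : ℕ) : IsCompact (ball N) := by
  have h : ball N = {x | ∑ i, x i ^ 2 ≤ 1} := Set.ext fun _ => mem_ball_iff
  have hcl : IsClosed (ball N) := h ▸ isClosed_le (by fun_prop) continuous_const
  refine (isCompact_Icc (a := fun _ : Fin N => (-1 : ℝ)) (b := fun _ => 1)).of_isClosed_subset
    hcl ?_
  intro x hx
  have hi : ∀ i, |x i| ≤ 1 := fun i => (sq_le_one_iff_abs_le_one (x i)).1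
    ((single_le_sum (f := fun k => x k ^ 2) (fun k _ => sq_nonneg _) (mem_univ i)).trans
      (mem_ball_iff.1 hx))
  exact ⟨fun i => (abs_le.1 (hi i)).1, fun i => (abs_le.1 (hi i)).2⟩

theorem isCompact_sphere (N : ℕ) : IsCompact (sphere N) := by
  have h : sphere N = {x | ∑ i, x i ^ 2 = 1} := Set.ext fun _ => mem_sphere_iff
  exact (isCompact_ball N).of_isClosed_subset (h ▸ isClosed_eq (by fun_prop) continuous_const)
    (sphere_subset_ball N)

theorem sq_mem_simplex {N : ℕ} {x : Fin N → ℝ} (hx : x ∈ ball N) :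
    (fun i => x i ^ 2) ∈ simplex N :=
  ⟨fun _ => sq_nonneg _, mem_ball_iff.1 hx⟩

theorem faceLift_succ {e : ℕ} (x : Fin e → ℝ) :
    faceLift (e + 1) x = Fin.snoc (α := fun _ => ℝ) x (1 - ∑ j, x j) := by
  funext i
  refine Fin.lastCases ?_ (fun i => ?_) i
  · simp [faceLift]
  · rw [Fin.snoc_castSucc]
    simp [faceLift]

theorem faceLift_mem_simplex {e : ℕ} {x : Fin e → ℝ} (hx : x ∈ simplex e) :
    faceLift (e + 1) x ∈ simplex (e + 1) := by
  rw [faceLift_succ]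
  refine ⟨fun i => ?_, by simp [Fin.sum_univ_castSucc]⟩
  refine Fin.lastCases ?_ (fun i => ?_) i
  · simpa using hx.2
  · simpa using hx.1 i

theorem prod_faceLift {e : ℕ} (x : Fin e → ℝ) :
    ∏ i, faceLift (e + 1) x i = (∏ i, x i) * (1 - ∑ i, x i) := by
  rw [faceLift_succ, Fin.prod_univ_castSucc]
  simp

theorem totalDegree_bind₁_le {N M : ℕ} (φ : Fin N → MvPolynomial (Fin M) ℝ)
    (hφ : ∀ i, (φ i).totalDegree ≤ 1) (p : MvPolynomial (Fin N) ℝ) :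
    (bind₁ φ p).totalDegree ≤ p.totalDegree := by
  rw [bind₁, aeval_eq_eval₂Hom, coe_eval₂Hom, eval₂_eq']
  refine totalDegree_finsetSum_le fun m hm => ?_
  rw [algebraMap_eq]
  refine (totalDegree_C_mul_le _ _).trans (le_trans ?_ (le_totalDegree hm))
  refine (totalDegree_finsetProd _ _).trans ?_
  rw [Finsupp.sum_fintype _ _ fun _ => rfl]
  refine sum_le_sum fun i _ => (totalDegree_pow _ _).trans ?_
  exact (Nat.mul_le_mul_left _ (hφ i)).trans (mul_one _).le

/-- Restriction of polynomials to the hyperplane `x_1 + ⋯ + x_(e+1) = 1` does not raise the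
degree. -/
theorem exists_eval_faceLift {e : ℕ} (p : MvPolynomial (Fin (e + 1)) ℝ) :
    ∃ q : MvPolynomial (Fin e) ℝ, q.totalDegree ≤ p.totalDegree ∧
      ∀ x, eval x q = eval (faceLift (e + 1) x) p := by
  refine ⟨bind₁ (Fin.snoc (α := fun _ => MvPolynomial (Fin e) ℝ) X (1 - ∑ j, X j)) p,
    totalDegree_bind₁_le _ (fun i => ?_) p, fun x => ?_⟩
  · refine Fin.lastCases ?_ (fun i => ?_) i
    · rw [Fin.snoc_last]
      refine (totalDegree_sub _ _).trans (max_le (by simp) ?_)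
      exact totalDegree_finsetSum_le fun j _ => (totalDegree_X j).le
    · rw [Fin.snoc_castSucc, totalDegree_X]
  · rw [← coe_aeval_eq_eval, ← coe_aeval_eq_eval]
    simp only [RingHom.coe_coe]
    rw [aeval_bind₁, faceLift_succ]
    congr 2
    funext i
    refine Fin.lastCases ?_ (fun i => ?_) i <;> simp

theorem exists_inv_r_le_face {e : ℕ} (he : 3 ≤ e + 1) (p : MvPolynomial (Fin e) ℝ)
    (hp : p.totalDegree ≤ e) :
    ∃ x ∈ simplex e, (r (e + 1))⁻¹ ≤ |(∏ i, x i) * (1 - ∑ i, x i) - eval x p| := by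
  obtain ⟨x, hx0, hx1, h⟩ := exists_inv_r_le he (rename Fin.castSucc p)
    ((totalDegree_rename_le _ _).trans hp)
  rw [Fin.sum_univ_castSucc] at hx1
  rw [eval_rename, Fin.prod_univ_castSucc, eq_sub_of_add_eq' hx1] at h
  refine ⟨x ∘ Fin.castSucc, ⟨fun i => hx0 _, ?_⟩, h⟩
  have := hx0 (Fin.last e)
  simp only [Function.comp_apply]
  linarith

/-! ### Averaging over sign changes -/

/-- The sign `±1` attached to a Boolean. -/
def sgn (b : Bool) : ℝ := if b then -1 else 1

theorem sgn_sq (b : Bool) : sgn b ^ 2 = 1 := by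
  cases b <;> simp [sgn]

theorem exists_sum_signs_monomial {N n : ℕ} (m : Fin N →₀ ℕ) (hm : m.degree ≤ 2 * n + 1) (c : ℝ) :
    ∃ R : MvPolynomial (Fin N) ℝ, R.totalDegree ≤ n ∧ ∀ x : Fin N → ℝ,
      ∑ σ : Fin N → Bool, eval (fun i => sgn (σ i) * x i) (monomial m c) =
        eval (fun i => x i ^ 2) R := by
  have hsum : ∀ x : Fin N → ℝ,
      ∑ σ : Fin N → Bool, eval (fun i => sgn (σ i) * x i) (monomial m c) =
        c * ∏ i, ∑ b : Bool, (sgn b * x i) ^ m i := by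
    intro x
    rw [Fintype.prod_sum, mul_sum]
    refine sum_congr rfl fun σ _ => ?_
    rw [eval_monomial, Finsupp.prod_fintype _ _ fun _ => pow_zero _]
  by_cases h : ∀ i, Even (m i)
  · choose k hk using h
    refine ⟨C (c * 2 ^ N) * ∏ i, X i ^ k i, ?_, fun x => ?_⟩
    · refine (totalDegree_C_mul_le _ _).trans ((totalDegree_finsetProd _ _).trans ?_)
      have h1 : m.degree = 2 * ∑ i, k i := by
        rw [Finsupp.degree_eq_sum, mul_sum]
        exact sum_congr rfl fun i _ => by rw [hk i]; ring
      simp only [totalDegree_X_pow]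
      omega
    · rw [hsum]
      have h2 : ∀ i, ∑ b : Bool, (sgn b * x i) ^ m i = 2 * (x i ^ 2) ^ k i := by
        intro i
        rw [Fintype.sum_bool, hk i, ← two_mul, pow_mul, pow_mul]
        simp only [mul_pow, sgn_sq, one_mul]
        ring
      simp only [h2, prod_mul_distrib, prod_const, card_univ, Fintype.card_fin, map_mul, eval_C,
        map_prod, map_pow, eval_X]
      ring
  · push Not at h
    obtain ⟨i, hi⟩ := h
    refine ⟨0, by simp, fun x => ?_⟩
    rw [hsum, prod_eq_zero (mem_univ i), mul_zero, map_zero]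
    rw [Fintype.sum_bool]
    simp [sgn, (Nat.not_even_iff_odd.1 hi).neg_pow]

/-- The sum of a polynomial over all sign changes of the coordinates is a polynomial of half the
degree in the squares of the coordinates. -/
theorem exists_sum_signs {N n : ℕ} (P : MvPolynomial (Fin N) ℝ) (hP : P.totalDegree ≤ 2 * n + 1) :
    ∃ R : MvPolynomial (Fin N) ℝ, R.totalDegree ≤ n ∧ ∀ x : Fin N → ℝ,
      ∑ σ : Fin N → Bool, eval (fun i => sgn (σ i) * x i) P = eval (fun i => x i ^ 2) R := by
  have h := fun m : P.support => exists_sum_signs_monomial (n := n) m.1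
    ((le_totalDegree m.2).trans hP) (coeff m.1 P)
  choose R hR hRe using h
  refine ⟨∑ m, R m, totalDegree_finsetSum_le fun m _ => hR m, fun x => ?_⟩
  rw [map_sum, ← sum_congr rfl fun m _ => hRe m x, sum_comm]
  refine sum_congr rfl fun σ _ => ?_
  conv_lhs => rw [P.as_sum, map_sum]
  rw [← sum_coe_sort P.support]

theorem exists_inv_r_le_sphere {d : ℕ} (hd : 3 ≤ d) (P : MvPolynomial (Fin d) ℝ)
    (hP : P.totalDegree ≤ 2 * d - 1) :
    ∃ x ∈ sphere d, (r d)⁻¹ ≤ |∏ i, x i ^ 2 - eval x P| := by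
  obtain ⟨R, hR, hPR⟩ := exists_sum_signs (n := d - 1) P (by omega)
  obtain ⟨x, hx0, hx1, h⟩ := exists_inv_r_le hd (C (2 ^ d)⁻¹ * R)
    ((totalDegree_C_mul_le _ _).trans hR)
  have hsq : ∀ i, √(x i) ^ 2 = x i := fun i => Real.sq_sqrt (hx0 i)
  have hav : ∑ _σ : Fin d → Bool, (r d)⁻¹ ≤ ∑ σ : Fin d → Bool,
      |∏ i, (sgn (σ i) * √(x i)) ^ 2 - eval (fun i => sgn (σ i) * √(x i)) P| := by
    refine le_trans ?_ (abs_sum_le_sum_abs _ _)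
    rw [sum_sub_distrib, hPR]
    simp only [mul_pow, sgn_sq, one_mul, hsq, sum_const, card_univ, Fintype.card_fun,
      Fintype.card_fin, Fintype.card_bool, nsmul_eq_mul]
    rw [map_mul, eval_C] at h
    push_cast
    have h2 : (0 : ℝ) < 2 ^ d := by positivity
    calc (2 : ℝ) ^ d * (r d)⁻¹ ≤ 2 ^ d * |∏ i, x i - (2 ^ d)⁻¹ * eval x R| := by gcongr
      _ = |2 ^ d * ∏ i, x i - eval x R| := by
        rw [← abs_of_pos h2, ← abs_mul, abs_of_pos h2, mul_sub, mul_inv_cancel_left₀ h2.ne']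
  obtain ⟨σ, _, hσ⟩ := exists_le_of_sum_le univ_nonempty hav
  refine ⟨fun i => sgn (σ i) * √(x i), ?_, hσ⟩
  rw [mem_sphere_iff]
  simpa only [mul_pow, sgn_sq, one_mul, hsq] using hx1

/-! ### Extremal polynomials on the four sets -/

/-- A normalized polynomial `r_d⁻¹ G = x_1 ⋯ x_d - p` for which `G` is bounded by one on the simplex
is extremal for all four approximation problems. -/
theorem isLeastDeviation_of_abs_le_one {e : ℕ} (he : 3 ≤ e + 1)
    {G : MvPolynomial (Fin (e + 1)) ℝ}
    (hG : ∃ p : MvPolynomial (Fin (e + 1)) ℝ, p.totalDegree ≤ e ∧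
      G = C (r (e + 1)) * esymm (Fin (e + 1)) ℝ (e + 1) + p)
    (hG1 : ∀ x ∈ simplex (e + 1), |eval x G| ≤ 1) :
    (bestApprox e (fun x => ∏ i, x i) (simplex (e + 1)) = (r (e + 1))⁻¹ ∧
      IsLeastDeviation e (fun x => ∏ i, x i) (simplex (e + 1))
        (fun x => (r (e + 1))⁻¹ * eval x G)) ∧
    (bestApprox e (fun x => (∏ i, x i) * (1 - ∑ i, x i)) (simplex e) = (r (e + 1))⁻¹ ∧
      IsLeastDeviation e (fun x => (∏ i, x i) * (1 - ∑ i, x i)) (simplex e)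
        (fun x => (r (e + 1))⁻¹ * eval (faceLift (e + 1) x) G)) ∧
    (bestApprox (2 * (e + 1) - 1) (fun x => ∏ i, x i ^ 2) (ball (e + 1)) = (r (e + 1))⁻¹ ∧
      IsLeastDeviation (2 * (e + 1) - 1) (fun x => ∏ i, x i ^ 2) (ball (e + 1))
        (fun x => (r (e + 1))⁻¹ * eval (fun i => x i ^ 2) G)) ∧
    (bestApprox (2 * (e + 1) - 1) (fun x => ∏ i, x i ^ 2) (sphere (e + 1)) = (r (e + 1))⁻¹ ∧
      IsLeastDeviation (2 * (e + 1) - 1) (fun x => ∏ i, x i ^ 2) (sphere (e + 1))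
        (fun x => (r (e + 1))⁻¹ * eval (fun i => x i ^ 2) G)) := by
  have hr := r_pos he
  have hE : 0 ≤ (r (e + 1))⁻¹ := by positivity
  obtain ⟨p, hp, hGp⟩ := hG
  have hq : (C (-(r (e + 1))⁻¹) * p).totalDegree ≤ e := (totalDegree_C_mul_le _ _).trans hp
  have hGq : ∀ x, (r (e + 1))⁻¹ * eval x G = ∏ i, x i - eval x (C (-(r (e + 1))⁻¹) * p) := by
    intro x
    rw [hGp, map_add, map_mul, map_mul, eval_C, eval_C, eval_esymm_card]
    field_simp
    ring
  have hle : ∀ x ∈ simplex (e + 1), |(r (e + 1))⁻¹ * eval x G| ≤ (r (e + 1))⁻¹ := by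
    intro x hx
    rw [abs_mul, abs_of_nonneg hE]
    exact mul_le_of_le_one_right hE (hG1 x hx)
  have hsq : ∃ q : MvPolynomial (Fin (e + 1)) ℝ, q.totalDegree ≤ 2 * (e + 1) - 1 ∧
      ∀ x, (r (e + 1))⁻¹ * eval (fun i => x i ^ 2) G = ∏ i, x i ^ 2 - eval x q := by
    refine ⟨expand 2 (C (-(r (e + 1))⁻¹) * p), ?_, fun x => ?_⟩
    · rw [totalDegree_expand]
      omega
    · rw [hGq, eval_expand]
      rfl
  refine ⟨?_, ?_, ?_, ?_⟩
  · refine bestApprox_eq_and_isLeastDeviation (isCompact_simplex _) (by fun_prop) hE ?_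
      ⟨_, hq, hGq⟩ hle
    intro p hp
    obtain ⟨x, hx0, hx1, h⟩ := exists_inv_r_le he p hp
    exact ⟨x, ⟨hx0, hx1.le⟩, h⟩
  · obtain ⟨q, hqd, hqe⟩ := exists_eval_faceLift (C (-(r (e + 1))⁻¹) * p)
    refine bestApprox_eq_and_isLeastDeviation (isCompact_simplex _) (by fun_prop) hE
      (exists_inv_r_le_face he) ⟨q, hqd.trans hq, fun x => ?_⟩
      fun x hx => hle _ (faceLift_mem_simplex hx)
    rw [hGq, prod_faceLift, hqe]
  · refine bestApprox_eq_and_isLeastDeviation (isCompact_ball _) (by fun_prop) hE ?_ hsq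
      fun x hx => hle _ (sq_mem_simplex hx)
    intro P hP
    obtain ⟨x, hx, h⟩ := exists_inv_r_le_sphere he P hP
    exact ⟨x, sphere_subset_ball _ hx, h⟩
  · exact bestApprox_eq_and_isLeastDeviation (isCompact_sphere _) (by fun_prop) hE
      (exists_inv_r_le_sphere he) hsq fun x hx => hle _ (sq_mem_simplex (sphere_subset_ball _ hx))

end LeastDeviation

open LeastDeviation in
theorem theorem4p1 (d : ℕ) (hd : 3 ≤ d) :
    0 < r d ∧
    -- the simplices of dimension `d` and `d - 1`
    bestApprox (d - 1) (fun x => ∏ i, x i) (simplex d) =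
      bestApprox (d - 1) (fun x => (∏ i, x i) * (1 - ∑ i, x i)) (simplex (d - 1)) ∧
    (r d)⁻¹ ≤ bestApprox (d - 1) (fun x => ∏ i, x i) (simplex d) ∧
    -- the ball and the sphere
    bestApprox (2 * d - 1) (fun x => ∏ i, x i ^ 2) (ball d) =
      bestApprox (2 * d - 1) (fun x => ∏ i, x i ^ 2) (sphere d) ∧
    (r d)⁻¹ ≤ bestApprox (2 * d - 1) (fun x => ∏ i, x i ^ 2) (ball d) ∧
    -- equality and extremal polynomials in low dimension
    (d = 3 ∨ d = 4 ∨ d = 5 →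
      bestApprox (d - 1) (fun x => ∏ i, x i) (simplex d) = (r d)⁻¹ ∧
      IsLeastDeviation (d - 1) (fun x => ∏ i, x i) (simplex d)
        (fun x => (r d)⁻¹ * MvPolynomial.eval x (T d d)) ∧
      IsLeastDeviation (d - 1) (fun x => (∏ i, x i) * (1 - ∑ i, x i)) (simplex (d - 1))
        (fun x => (r d)⁻¹ * MvPolynomial.eval (faceLift d x) (T d d)) ∧
      bestApprox (2 * d - 1) (fun x => ∏ i, x i ^ 2) (ball d) = (r d)⁻¹ ∧
      IsLeastDeviation (2 * d - 1) (fun x => ∏ i, x i ^ 2) (ball d)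
        (fun x => (r d)⁻¹ * MvPolynomial.eval (fun i => x i ^ 2) (T d d)) ∧
      IsLeastDeviation (2 * d - 1) (fun x => ∏ i, x i ^ 2) (sphere d)
        (fun x => (r d)⁻¹ * MvPolynomial.eval (fun i => x i ^ 2) (T d d))) := by
  obtain ⟨e, rfl⟩ : ∃ e, d = e + 1 := ⟨d - 1, by omega⟩
  obtain ⟨⟨hA, -⟩, ⟨hB, -⟩, ⟨hC, -⟩, hD, -⟩ := isLeastDeviation_of_abs_le_one hd
    (exists_extremal_eq hd) fun x hx => abs_eval_extremal_le hx
  refine ⟨r_pos hd, hA.trans hB.symm, hA.ge, hC.trans hD.symm, hC.ge, fun h => ?_⟩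
  have hT : ∃ p : MvPolynomial (Fin (e + 1)) ℝ, p.totalDegree ≤ e ∧ T (e + 1) (e + 1) =
      MvPolynomial.C (r (e + 1)) * MvPolynomial.esymm (Fin (e + 1)) ℝ (e + 1) + p := by
    obtain ⟨k, rfl⟩ : ∃ k, e = k + 2 := ⟨e - 2, by omega⟩
    exact exists_T_eq k _
  obtain ⟨⟨hA, hA'⟩, ⟨-, hB'⟩, ⟨hC, hC'⟩, -, hD'⟩ := isLeastDeviation_of_abs_le_one hd hT
    fun x hx => abs_eval_T_le h hx
  exact ⟨hA, hA', hB', hC, hC', hD'⟩
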